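/- Let $T:[0,1]\to[0,1]$ be a Borel measurable map (neither continuity nor surjectivity is assumed). Let $V:[0,+\infty)\to[0,1)$ be continuous and increasing, with $V(x)\in(0,1)$ for $x>0$, and regularly varying at $0$ with index $\sigma>0$, that is, $$\lim_{x\to0^+}\frac{V(tx)}{V(x)}=t^{\sigma}\qquad\text{for all } t>0 .$$ Suppose that on some neighbourhood of $0$ in $[0,1]$ the map $T$ is injective and has the form $T(x)=x(1+V(x))$, or is injective and has the form $T(x)=x(1-V(x))$. Let $\omega:[0,+\infty)\to[0,+\infty)$ be a concave modulus of continuity, that is, a continuous, non-decreasing, concave function with $\omega(0)=0$, and suppose that $$\liminf_{x\to0^+}\frac{\omega(x)}{V(x)}>0$$ (the value $+\infty$ is allowed). Let $\mathscr C^{\omega}([0,1])$ be the space of functions $\varphi:[0,1]\to\mathbb R$ for which there is $C>0$ with $|\varphi(x)-\varphi(y)|\le C\,\omega(|x-y|)$ for all $x,y\in[0,1]$. Then there exists $f\in\mathscr C^{\omega}([0,1])$ such that the maximum $$m(f,T)=\max\Big\{\int f\,d\mu:\ \mu\text{ a }T\text{-invariant Borel probability measure on }[0,1]\Big\}$$ is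 attained and equals $\int f\,d\delta_0=f(0)$, and such that $f$ admits no continuous sub-action: there is no continuous $u:[0,1]\to\mathbb R$ with $f(x)+u(x)-u(T(x))\le m(f,T)$ for all $x\in[0,1]$. -/

import Mathlib

open Set Filter Topology MeasureTheory

/-- `V` is regularly varying at `0` with index `σ`: `V (t x) / V x → t ^ σ` as `x → 0⁺`,
for every `t > 0`. -/
def RegularlyVaryingAtZero (V : ℝ → ℝ) (σ : ℝ) : Prop :=
  ∀ t : ℝ, 0 < t → Tendsto (fun x : ℝ => V (t * x) / V x) (𝓝[>] 0) (𝓝 (t ^ σ))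

/-- Concave moduli of continuity: continuous, non-decreasing, concave functions on `[0, ∞)`
that vanish at `0` (so they are nonnegative there). Only the values on `[0, ∞)` matter. -/
structure IsConcaveModulus (ω : ℝ → ℝ) : Prop where
  continuousOn : ContinuousOn ω (Ici 0)
  monotoneOn : MonotoneOn ω (Ici 0)
  map_zero : ω 0 = 0
  concaveOn : ConcaveOn ℝ (Ici 0) ω

/-- The class of functions `φ : [0,1] → ℝ` having a multiple of `ω` as modulus of continuity. -/
def ModulusClass (ω : ℝ → ℝ) : Set (Icc (0 : ℝ) 1 → ℝ) :=
  {φ | ∃ C : ℝ, 0 < C ∧ ∀ x y, |φ x - φ y| ≤ C * ω (dist x y)}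

/-- The averages `∫ f dμ` over all `T`-invariant Borel probability measures `μ` on `[0,1]`. -/
def ergodicAverages (T : Icc (0 : ℝ) 1 → Icc (0 : ℝ) 1) (f : Icc (0 : ℝ) 1 → ℝ) : Set ℝ :=
  {r | ∃ μ : Measure (Icc (0 : ℝ) 1),
    IsProbabilityMeasure μ ∧ MeasurePreserving T μ μ ∧ ∫ x, f x ∂μ = r}

/-- The maximum ergodic average `m(f, T)`. -/
noncomputable def maxErgodicAverage (T : Icc (0 : ℝ) 1 → Icc (0 : ℝ) 1)
    (f : Icc (0 : ℝ) 1 → ℝ) : ℝ :=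
  sSup (ergodicAverages T f)

/-- `u` is a sub-action for `f`: `f + u - u ∘ T ≤ m(f, T)`. -/
def IsSubAction (T : Icc (0 : ℝ) 1 → Icc (0 : ℝ) 1) (f u : Icc (0 : ℝ) 1 → ℝ) : Prop :=
  ∀ x, f x + u x - u (T x) ≤ maxErgodicAverage T f

/-- The mean value of `V` over `[0, x]`. -/
noncomputable def meanValue (V : ℝ → ℝ) (x : ℝ) : ℝ := (∫ t in (0 : ℝ)..x, V t) / x

lemma meanValue_zero (V : ℝ → ℝ) : meanValue V 0 = 0 := by simp [meanValue]

section MeanValue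

variable {V : ℝ → ℝ}

lemma intervalIntegrable_of_monotoneOn_Ici (hV : MonotoneOn V (Ici 0)) {a b : ℝ} (ha : 0 ≤ a)
    (hb : 0 ≤ b) : IntervalIntegrable V volume a b :=
  (hV.mono fun _ hx => (le_min ha hb).trans hx.1).intervalIntegrable

lemma integral_le_of_monotoneOn (hV : MonotoneOn V (Ici 0)) {a b : ℝ} (ha : 0 ≤ a)
    (hab : a ≤ b) : ∫ t in a..b, V t ≤ (b - a) * V b := by
  have h := intervalIntegral.integral_mono_on_of_le_Ioo hab
    (intervalIntegrable_of_monotoneOn_Ici hV ha (ha.trans hab))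
    (intervalIntegrable_const (c := V b) (μ := volume))
    fun x hx => hV (ha.trans hx.1.le) (ha.trans hab) hx.2.le
  simpa using h

lemma le_integral_of_monotoneOn (hV : MonotoneOn V (Ici 0)) {a b : ℝ} (ha : 0 ≤ a)
    (hab : a ≤ b) : (b - a) * V a ≤ ∫ t in a..b, V t := by
  have h := intervalIntegral.integral_mono_on_of_le_Ioo hab
    (intervalIntegrable_const (c := V a) (μ := volume))
    (intervalIntegrable_of_monotoneOn_Ici hV ha (ha.trans hab))
    fun x hx => hV ha (ha.trans hx.1.le) hx.1.le
  simpa using h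

lemma integral_nonneg_of_pos (hV : MonotoneOn V (Ici 0)) (hpos : ∀ x, 0 < x → 0 < V x) {x : ℝ}
    (hx : 0 ≤ x) : 0 ≤ ∫ t in (0 : ℝ)..x, V t := by
  have h := intervalIntegral.integral_mono_on_of_le_Ioo hx
    (intervalIntegrable_const (c := (0 : ℝ)) (μ := volume))
    (intervalIntegrable_of_monotoneOn_Ici hV le_rfl hx) fun y hy => (hpos y hy.1).le
  simpa using h

lemma meanValue_nonneg (hV : MonotoneOn V (Ici 0)) (hpos : ∀ x, 0 < x → 0 < V x) {x : ℝ}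
    (hx : 0 ≤ x) : 0 ≤ meanValue V x :=
  div_nonneg (integral_nonneg_of_pos hV hpos hx) hx

lemma meanValue_le (hV : MonotoneOn V (Ici 0)) {x : ℝ} (hx : 0 < x) : meanValue V x ≤ V x := by
  have h := integral_le_of_monotoneOn hV le_rfl hx.le
  rw [meanValue, div_le_iff₀ hx]
  linarith

lemma half_le_meanValue (hV : MonotoneOn V (Ici 0)) (hpos : ∀ x, 0 < x → 0 < V x) {x : ℝ}
    (hx : 0 < x) : V (x / 2) / 2 ≤ meanValue V x := by
  have h0 := integral_nonneg_of_pos hV hpos (half_pos hx).le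
  have h1 := le_integral_of_monotoneOn hV (half_pos hx).le (half_le_self hx.le)
  have h2 := intervalIntegral.integral_add_adjacent_intervals
    (intervalIntegrable_of_monotoneOn_Ici hV le_rfl (half_pos hx).le)
    (intervalIntegrable_of_monotoneOn_Ici hV (half_pos hx).le hx.le)
  rw [meanValue, le_div_iff₀ hx]
  linarith

lemma abs_meanValue_sub_le (hV : MonotoneOn V (Ici 0)) (hpos : ∀ x, 0 < x → 0 < V x) {x y : ℝ}
    (hx : 0 < x) (hxy : x ≤ y) :
    |meanValue V y - meanValue V x| ≤ (y - x) * (V y / y) := by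
  have hy : 0 < y := hx.trans_le hxy
  have h0 := integral_nonneg_of_pos hV hpos hx.le
  have h1 := le_integral_of_monotoneOn hV hx.le hxy
  have h2 := integral_le_of_monotoneOn hV hx.le hxy
  have h3 := intervalIntegral.integral_add_adjacent_intervals
    (intervalIntegrable_of_monotoneOn_Ici hV le_rfl hx.le)
    (intervalIntegrable_of_monotoneOn_Ici hV hx.le hy.le)
  have h4 := meanValue_le hV hx
  have h5 := meanValue_nonneg hV hpos hx.le
  have h6 : V x ≤ V y := hV hx.le hy.le hxy
  have h7 : 0 < V x := hpos x hx
  have e1 : ∫ t in (0 : ℝ)..x, V t = meanValue V x * x := by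
    rw [meanValue, div_mul_cancel₀ _ hx.ne']
  have e2 : meanValue V y - meanValue V x
      = ((∫ t in x..y, V t) - (y - x) * meanValue V x) / y := by
    have : meanValue V y = (∫ t in (0 : ℝ)..y, V t) / y := rfl
    rw [this, ← h3, e1]
    field_simp
    ring
  have h8 : 0 ≤ y - x := sub_nonneg.2 hxy
  rw [e2, abs_div, abs_of_pos hy, ← mul_div_assoc]
  gcongr
  rw [abs_le]
  constructor <;> nlinarith

end MeanValue

section ConcaveModulus

variable {ω : ℝ → ℝ}

lemma IsConcaveModulus.nonneg (hω : IsConcaveModulus ω) {x : ℝ} (hx : 0 ≤ x) : 0 ≤ ω x :=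
  hω.map_zero ▸ hω.monotoneOn self_mem_Ici hx hx

lemma IsConcaveModulus.mul_le_mul (hω : IsConcaveModulus ω) {x y : ℝ} (hx : 0 ≤ x) (hxy : x ≤ y) :
    x * ω y ≤ y * ω x := by
  rcases (hx.trans hxy).eq_or_lt with hy | hy
  · subst hy
    simp [le_antisymm hxy hx]
  have h := hω.concaveOn.2 (self_mem_Ici : (0 : ℝ) ∈ Ici 0) (hx.trans hxy : y ∈ Ici (0 : ℝ))
    (sub_nonneg.2 ((div_le_one hy).2 hxy)) (div_nonneg hx hy.le) (sub_add_cancel 1 (x / y))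
  simp only [hω.map_zero, smul_eq_mul, mul_zero, zero_add, div_mul_cancel₀ _ hy.ne'] at h
  rw [div_mul_eq_mul_div, div_le_iff₀ hy] at h
  linarith

/-- A function that is `O(ω)` at the origin and whose variation at scale `x` is controlled by
`ω x / x` has a multiple of `ω` as a modulus of continuity. -/
lemma IsConcaveModulus.abs_sub_le (hω : IsConcaveModulus ω) {g : ℝ → ℝ} {A B : ℝ} (hA : 0 ≤ A)
    (hB : 0 ≤ B) (hg : ∀ x ∈ Icc (0 : ℝ) 1, |g x| ≤ A * ω x)
    (hvar : ∀ x y, 0 < x → x ≤ y → y ≤ 1 → |g y - g x| ≤ B * ((y - x) * (ω x / x)))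
    {x y : ℝ} (hx : x ∈ Icc (0 : ℝ) 1) (hy : y ∈ Icc (0 : ℝ) 1) :
    |g x - g y| ≤ (3 * A + B) * ω |x - y| := by
  wlog hxy : x ≤ y generalizing x y
  · rw [abs_sub_comm, abs_sub_comm x y]
    exact this hy hx (le_of_not_ge hxy)
  have hd : 0 ≤ y - x := sub_nonneg.2 hxy
  have hωd := hω.nonneg hd
  rw [abs_sub_comm, abs_sub_comm x y, abs_of_nonneg hd]
  rcases le_or_gt x (y - x) with h | h
  · have h1 : ω x ≤ ω (y - x) := hω.monotoneOn hx.1 hd h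
    have h2 : ω y ≤ 2 * ω (y - x) := by
      rcases hd.eq_or_lt with h0 | h0
      · have : y = 0 := by linarith [hx.1]
        subst this
        linarith [hω.map_zero]
      have := hω.mul_le_mul hd (show y - x ≤ y by linarith [hx.1])
      have h3 : y * ω (y - x) ≤ (2 * (y - x)) * ω (y - x) := by gcongr; linarith
      exact le_of_mul_le_mul_left (by linarith) h0
    calc |g y - g x| ≤ |g y| + |g x| := abs_sub _ _
      _ ≤ A * ω y + A * ω x := add_le_add (hg y hy) (hg x hx)
      _ ≤ A * (2 * ω (y - x)) + A * ω (y - x) := by gcongr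
      _ ≤ (3 * A + B) * ω (y - x) := by nlinarith [mul_nonneg hB hωd]
  · have hx0 : 0 < x := hd.trans_lt h
    have h1 := hω.mul_le_mul hd h.le
    calc |g y - g x| ≤ B * ((y - x) * (ω x / x)) := hvar x y hx0 hxy hy.2
      _ ≤ B * ω (y - x) := by
        gcongr
        rw [← mul_div_assoc, div_le_iff₀ hx0]
        linarith
      _ ≤ (3 * A + B) * ω (y - x) := by nlinarith [mul_nonneg hA hωd]

end ConcaveModulus

/-- A `2π`-periodic weight with the sign of `cos - 1 / 2`. -/
noncomputable def cosWeight (K s : ℝ) : ℝ :=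
  min ((Real.cos s - 1 / 2) / 2) (K * (Real.cos s - 1 / 2))

lemma abs_cosWeight_le {K : ℝ} (hK : 1 / 2 ≤ K) (s : ℝ) : |cosWeight K s| ≤ 2 * K := by
  have h1 := Real.cos_le_one s
  have h2 := Real.neg_one_le_cos s
  rw [cosWeight, abs_le]
  exact ⟨le_min (by linarith) (by nlinarith), (min_le_right _ _).trans (by nlinarith)⟩

lemma cosWeight_le (K s : ℝ) : cosWeight K s ≤ 1 / 4 :=
  (min_le_left _ _).trans (by linarith [Real.cos_le_one s])

lemma abs_cosWeight_sub_le {K : ℝ} (hK : 1 / 2 ≤ K) (s t : ℝ) :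
    |cosWeight K s - cosWeight K t| ≤ K * |s - t| := by
  have h := Real.abs_cos_sub_cos_le s t
  refine (abs_min_sub_min_le_max _ _ _ _).trans (max_le ?_ ?_)
  · rw [show (Real.cos s - 1 / 2) / 2 - (Real.cos t - 1 / 2) / 2
      = (1 / 2) * (Real.cos s - Real.cos t) by ring, abs_mul, abs_of_pos one_half_pos]
    gcongr
  · rw [← mul_sub, sub_sub_sub_cancel_right, abs_mul, abs_of_nonneg (by linarith)]
    gcongr

lemma abs_sin_sub_sin_sub_le (a b : ℝ) :
    |Real.sin b - Real.sin a - (b - a) * Real.cos a| ≤ (b - a) ^ 2 := by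
  have hd : ∀ x, HasDerivAt (fun x => Real.sin x - x * Real.cos a) (Real.cos x - Real.cos a) x :=
    fun x => by
      simpa using (Real.hasDerivAt_sin x).fun_sub ((hasDerivAt_id x).mul_const (Real.cos a))
  have h := Convex.norm_image_sub_le_of_norm_hasDerivWithin_le (s := uIcc a b) (C := |b - a|)
    (x := a) (y := b) (fun x _ => (hd x).hasDerivWithinAt)
    (fun x hx => (Real.abs_cos_sub_cos_le x a).trans (abs_sub_left_of_mem_uIcc hx))
    (convex_uIcc a b) left_mem_uIcc right_mem_uIcc
  rw [Real.norm_eq_abs, Real.norm_eq_abs, abs_mul_abs_self, ← sq] at h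
  convert h using 2
  ring

/-- The weight is dominated by the increments of `± sin` along small steps. -/
lemma cosWeight_mul_le {K h g s : ℝ} (hg0 : 0 ≤ g) (h0 : 0 ≤ h) (h1 : h ≤ 1 / 2)
    (hg : g ≤ 2 * h) (hK : h ≤ K * g) {ε : ℝ} (hε : ε = 1 ∨ ε = -1) :
    cosWeight K s * g ≤ ε * Real.sin (s + ε * h) - ε * Real.sin s := by
  have key : h * (Real.cos s - 1 / 2) ≤ ε * Real.sin (s + ε * h) - ε * Real.sin s := by
    have := abs_le.1 (abs_sin_sub_sin_sub_le s (s + ε * h))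
    rcases hε with rfl | rfl
    · nlinarith [this.1]
    · nlinarith [this.2]
  refine le_trans ?_ key
  rcases le_total 0 (Real.cos s - 1 / 2) with hc | hc
  · calc cosWeight K s * g ≤ (Real.cos s - 1 / 2) / 2 * g := by
          gcongr; exact min_le_left _ _
      _ ≤ h * (Real.cos s - 1 / 2) := by nlinarith
  · calc cosWeight K s * g ≤ K * (Real.cos s - 1 / 2) * g := by
          gcongr; exact min_le_right _ _
      _ ≤ h * (Real.cos s - 1 / 2) := by nlinarith

/-- The weight `cosWeight K (log x)`, scaled by the mean value of `V`, minus a ramp starting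
at `r`. -/
noncomputable def logOscillation (V : ℝ → ℝ) (K r x : ℝ) : ℝ :=
  cosWeight K (Real.log x) * meanValue V x - 3 / r * max (x - r) 0

lemma logOscillation_zero (V : ℝ → ℝ) (K : ℝ) {r : ℝ} (hr : 0 ≤ r) : logOscillation V K r 0 = 0 := by
  simp [logOscillation, meanValue_zero, hr]

section Comparison

variable {V : ℝ → ℝ}

lemma RegularlyVaryingAtZero.exists_two_mul_le_meanValue {σ : ℝ}
    (hreg : RegularlyVaryingAtZero V σ) (hV : MonotoneOn V (Ici 0)) (hpos : ∀ x, 0 < x → 0 < V x) :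
    ∃ K, 1 / 2 ≤ K ∧ ∃ R, 0 < R ∧ ∀ x, 0 < x → x < R → 2 * V x ≤ K * meanValue V x := by
  have ha : (0 : ℝ) < (1 / 2) ^ σ := by positivity
  obtain ⟨R, hR, h⟩ := mem_nhdsGT_iff_exists_Ioo_subset.1
    ((hreg (1 / 2) one_half_pos).eventually_const_lt (half_lt_self ha))
  refine ⟨8 / (1 / 2) ^ σ + 1, by linarith [div_pos (show (0 : ℝ) < 8 by norm_num) ha], R, hR,
    fun x hx hxR => ?_⟩
  have h1 : (1 / 2) ^ σ / 2 < V (1 / 2 * x) / V x := h ⟨hx, hxR⟩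
  rw [lt_div_iff₀ (hpos x hx), one_div_mul_eq_div] at h1
  have h2 := half_le_meanValue hV hpos hx
  have h3 := meanValue_nonneg hV hpos hx.le
  calc 2 * V x = 8 / (1 / 2) ^ σ * ((1 / 2) ^ σ / 2 * V x / 2) := by field_simp; ring
    _ ≤ 8 / (1 / 2) ^ σ * meanValue V x := by gcongr; linarith
    _ ≤ _ := by linarith

lemma IsConcaveModulus.exists_mul_le {ω : ℝ → ℝ} (hω : IsConcaveModulus ω)
    (hmem : ∀ x, 0 < x → V x ∈ Ioo (0 : ℝ) 1)
    (hliminf : 0 < liminf (fun x : ℝ => ((ω x / V x : ℝ) : EReal)) (𝓝[>] 0)) :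
    ∃ c, 0 < c ∧ ∀ x, 0 < x → c * V x ≤ ω x := by
  obtain ⟨c, hc0, hc⟩ := EReal.lt_iff_exists_real_btwn.1 hliminf
  have hc0' : 0 < c := EReal.coe_pos.1 hc0
  obtain ⟨R, hR, h⟩ := mem_nhdsGT_iff_exists_Ioo_subset.1 (eventually_lt_of_lt_liminf hc)
  have hR' : 0 < R := hR
  have h' : ∀ x, 0 < x → x < R → c * V x ≤ ω x := fun x hx hxR => by
    have : ((c : ℝ) : EReal) < ((ω x / V x : ℝ) : EReal) := h ⟨hx, hxR⟩
    rw [EReal.coe_lt_coe_iff, lt_div_iff₀ (hmem x hx).1] at this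
    exact this.le
  have hm := hmem _ (half_pos hR')
  refine ⟨c * V (R / 2), mul_pos hc0' hm.1, fun x hx => ?_⟩
  have hx1 := hmem x hx
  rcases lt_or_ge x R with hxR | hxR
  · refine le_trans ?_ (h' x hx hxR)
    gcongr ?_ * _
    · exact hx1.1.le
    · exact mul_le_of_le_one_right hc0'.le hm.2.le
  · calc c * V (R / 2) * V x ≤ c * V (R / 2) :=
          mul_le_of_le_one_right (mul_pos hc0' hm.1).le hx1.2.le
      _ ≤ ω (R / 2) := h' _ (half_pos hR') (half_lt_self hR')
      _ ≤ ω x := hω.monotoneOn (half_pos hR').le hx.le (by linarith)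

lemma IsConcaveModulus.exists_le_quarter {ω : ℝ → ℝ} (hω : IsConcaveModulus ω) {c : ℝ}
    (hc : 0 < c) (hle : ∀ x, 0 < x → c * V x ≤ ω x) :
    ∃ R, 0 < R ∧ ∀ x, 0 < x → x < R → V x ≤ 1 / 4 := by
  have h : Tendsto ω (𝓝[>] 0) (𝓝 0) := by
    have := (hω.continuousOn 0 self_mem_Ici).mono_left (nhdsWithin_mono 0 Ioi_subset_Ici_self)
    rwa [hω.map_zero] at this
  obtain ⟨R, hR, hsub⟩ := mem_nhdsGT_iff_exists_Ioo_subset.1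
    (h.eventually_lt_const (show 0 < c / 4 by positivity))
  refine ⟨R, hR, fun x hx hxR => ?_⟩
  have h1 : ω x < c / 4 := hsub ⟨hx, hxR⟩
  exact le_of_mul_le_mul_left (by linarith [hle x hx]) hc

lemma logOscillation_mem_modulusClass {ω : ℝ → ℝ} (hω : IsConcaveModulus ω)
    (hV : MonotoneOn V (Ici 0)) (hmem : ∀ x, 0 < x → V x ∈ Ioo (0 : ℝ) 1) {c : ℝ} (hc : 0 < c)
    (hle : ∀ x, 0 < x → c * V x ≤ ω x) {K r : ℝ} (hK : 1 / 2 ≤ K) (hr : 0 < r) :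
    (fun x : Icc (0 : ℝ) 1 => logOscillation V K r x) ∈ ModulusClass ω := by
  have hpos : ∀ x, 0 < x → 0 < V x := fun x hx => (hmem x hx).1
  have hV' : ∀ x, 0 < x → V x ≤ ω x / c := fun x hx => by
    rw [le_div_iff₀' hc]; exact hle x hx
  have hω1 : 0 < ω 1 := (mul_pos hc (hpos 1 one_pos)).trans_le (hle 1 one_pos)
  have hosc : ∀ {x y : ℝ}, x ∈ Icc (0 : ℝ) 1 → y ∈ Icc (0 : ℝ) 1 →
      |cosWeight K (Real.log x) * meanValue V x - cosWeight K (Real.log y) * meanValue V y|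
        ≤ (3 * (2 * K / c) + 3 * K / c) * ω |x - y| := by
    refine hω.abs_sub_le (g := fun x => cosWeight K (Real.log x) * meanValue V x)
      (by positivity) (by positivity) (fun x hx => ?_) (fun x y hx hxy hy => ?_)
    · rcases hx.1.eq_or_lt with rfl | hx0
      · simp [meanValue_zero, hω.map_zero]
      rw [abs_mul, abs_of_nonneg (meanValue_nonneg hV hpos hx0.le)]
      calc |cosWeight K (Real.log x)| * meanValue V x ≤ 2 * K * (ω x / c) :=
            mul_le_mul (abs_cosWeight_le hK _) ((meanValue_le hV hx0).trans (hV' x hx0))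
              (meanValue_nonneg hV hpos hx0.le) (by positivity)
        _ = 2 * K / c * ω x := by ring
    · have hy0 := hx.trans_le hxy
      have hd : 0 ≤ y - x := sub_nonneg.2 hxy
      have hlog : |Real.log y - Real.log x| ≤ (y - x) / x := by
        rw [abs_of_nonneg (sub_nonneg.2 (Real.log_le_log hx hxy)), ← Real.log_div hy0.ne' hx.ne',
          sub_div, div_self hx.ne']
        exact Real.log_le_sub_one_of_pos (div_pos hy0 hx)
      have hωy : ω y / y ≤ ω x / x := by
        rw [div_le_div_iff₀ hy0 hx]
        linarith [hω.mul_le_mul hx.le hxy]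
      have h1 : |meanValue V y - meanValue V x| ≤ (y - x) * (ω x / x / c) := by
        refine (abs_meanValue_sub_le hV hpos hx hxy).trans ?_
        refine mul_le_mul_of_nonneg_left ?_ hd
        calc V y / y ≤ ω y / c / y := by gcongr; exact hV' y hy0
          _ = ω y / y / c := by ring
          _ ≤ ω x / x / c := by gcongr
      have h2 : |meanValue V x| ≤ ω x / c := by
        rw [abs_of_nonneg (meanValue_nonneg hV hpos hx.le)]
        exact (meanValue_le hV hx).trans (hV' x hx)
      calc |cosWeight K (Real.log y) * meanValue V y - cosWeight K (Real.log x) * meanValue V x|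
          = |cosWeight K (Real.log y) * (meanValue V y - meanValue V x)
            + (cosWeight K (Real.log y) - cosWeight K (Real.log x)) * meanValue V x| := by
            congr 1; ring
        _ ≤ |cosWeight K (Real.log y)| * |meanValue V y - meanValue V x|
            + |cosWeight K (Real.log y) - cosWeight K (Real.log x)| * |meanValue V x| := by
            rw [← abs_mul, ← abs_mul]; exact abs_add_le _ _
        _ ≤ 2 * K * ((y - x) * (ω x / x / c)) + K * ((y - x) / x) * (ω x / c) := by
            gcongr
            · exact abs_cosWeight_le hK _
            · exact (abs_cosWeight_sub_le hK _ _).trans (by gcongr)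
        _ = 3 * K / c * ((y - x) * (ω x / x)) := by ring
  refine ⟨3 * (2 * K / c) + 3 * K / c + 3 / r / ω 1, by positivity, fun x y => ?_⟩
  have h1 := hosc x.2 y.2
  have hd : dist x y = |(x : ℝ) - y| := by rw [Subtype.dist_eq, Real.dist_eq]
  have hd1 : dist x y ≤ 1 := by
    rw [hd, abs_le]; constructor <;> linarith [x.2.1, x.2.2, y.2.1, y.2.2]
  have h2 : |max ((x : ℝ) - r) 0 - max ((y : ℝ) - r) 0| ≤ ω (dist x y) / ω 1 := by
    rw [le_div_iff₀ hω1]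
    calc _ ≤ dist x y * ω 1 := by
          gcongr
          rw [hd]
          simpa using abs_max_sub_max_le_max ((x : ℝ) - r) 0 (y - r) 0
      _ ≤ ω (dist x y) := by simpa using hω.mul_le_mul dist_nonneg hd1
  rw [← hd] at h1
  calc |logOscillation V K r x - logOscillation V K r y|
      = |(cosWeight K (Real.log x) * meanValue V x - cosWeight K (Real.log y) * meanValue V y)
        - 3 / r * (max ((x : ℝ) - r) 0 - max ((y : ℝ) - r) 0)| := by
        congr 1; simp only [logOscillation]; ring
    _ ≤ _ + |3 / r * (max ((x : ℝ) - r) 0 - max ((y : ℝ) - r) 0)| := abs_sub _ _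
    _ ≤ (3 * (2 * K / c) + 3 * K / c) * ω (dist x y) + 3 / r * (ω (dist x y) / ω 1) := by
        rw [abs_mul, abs_of_pos (show 0 < 3 / r by positivity)]
        gcongr
    _ = _ := by ring

end Comparison

lemma IsConcaveModulus.continuous_of_mem {ω : ℝ → ℝ} (hω : IsConcaveModulus ω)
    {f : Icc (0 : ℝ) 1 → ℝ} (hf : f ∈ ModulusClass ω) : Continuous f := by
  obtain ⟨C, -, hC⟩ := hf
  refine continuous_iff_continuousAt.2 fun a => tendsto_iff_dist_tendsto_zero.2 ?_
  have h1 : Tendsto (fun x => dist x a) (𝓝 a) (𝓝[≥] 0) :=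
    tendsto_nhdsWithin_iff.2 ⟨tendsto_iff_dist_tendsto_zero.1 tendsto_id,
      Eventually.of_forall fun _ => dist_nonneg⟩
  have h2 := ((hω.continuousOn 0 self_mem_Ici).tendsto.comp h1).const_mul C
  rw [hω.map_zero, mul_zero] at h2
  exact squeeze_zero (fun _ => dist_nonneg) (fun x => hC x a) h2

/-- A function dominated by a bounded measurable coboundary has nonpositive integral against every
invariant probability measure. -/
lemma integral_nonpos_of_le_coboundary {X : Type*} [MeasurableSpace X] {μ : Measure X}
    [IsProbabilityMeasure μ] {T : X → X} (hT : MeasurePreserving T μ μ) {f w : X → ℝ}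
    (hf : Integrable f μ) (hw : Measurable w) {B : ℝ} (hB : ∀ x, |w x| ≤ B)
    (hle : ∀ x, f x ≤ w (T x) - w x) : ∫ x, f x ∂μ ≤ 0 := by
  have hwi : Integrable w μ := .of_bound hw.aestronglyMeasurable B (.of_forall hB)
  have hwT : Integrable (fun x => w (T x)) μ :=
    .of_bound (hw.comp hT.measurable).aestronglyMeasurable B (.of_forall fun x => hB _)
  have heq : ∫ x, w (T x) ∂μ = ∫ x, w x ∂μ := by
    rw [← integral_map hT.measurable.aemeasurable hw.aestronglyMeasurable, hT.map_eq]
  calc ∫ x, f x ∂μ ≤ ∫ x, (w (T x) - w x) ∂μ := integral_mono hf (hwT.sub hwi) hle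
    _ = 0 := by rw [integral_sub hwT hwi, heq, sub_self]

/-- If the height `y` increases by a definite amount along orbits in the band `|y| ≤ 1 / 2`, and
`u` increases at least proportionally, then `u` increases by a definite amount across the band. -/
lemma exists_add_le_of_crossing {X : Type*} {T : X → X} {y u : X → ℝ} {η c : ℝ} (hη : 0 < η)
    (hc : 0 ≤ c)
    (hstep : ∀ x, |y x| ≤ 1 / 2 →
      y x + η ≤ y (T x) ∧ y (T x) ≤ y x + 1 / 2 ∧ c * (y (T x) - y x) ≤ u (T x) - u x)
    {a : X} (ha : y a = -1 / 2) : ∃ z, y z ∈ Icc (1 / 2) 1 ∧ u a + c ≤ u z := by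
  by_contra! hne
  have key : ∀ n : ℕ, -1 / 2 + n * η ≤ y (T^[n] a) ∧ y (T^[n] a) < 1 / 2 ∧
      c * (y (T^[n] a) + 1 / 2) ≤ u (T^[n] a) - u a := by
    intro n
    induction n with
    | zero => simp [ha]; norm_num
    | succ n ih =>
      obtain ⟨h1, h2, h3⟩ := ih
      have hn : 0 ≤ n * η := by positivity
      obtain ⟨s1, s2, s3⟩ := hstep (T^[n] a) (abs_le.2 ⟨by linarith, h2.le⟩)
      rw [Function.iterate_succ_apply']
      have h4 : c * (y (T (T^[n] a)) + 1 / 2) ≤ u (T (T^[n] a)) - u a := by linarith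
      refine ⟨by push_cast; linarith, ?_, h4⟩
      by_contra! hge
      have := hne _ ⟨hge, by linarith⟩
      nlinarith
  obtain ⟨n, hn⟩ := exists_nat_gt (1 / η)
  rw [div_lt_iff₀ hη] at hn
  linarith [key n]

/-- On the logarithmic scale, a map `x (1 ± V x)` moves points by an amount comparable to `V`. -/
lemma exists_log_step {T : Icc (0 : ℝ) 1 → Icc (0 : ℝ) 1} {V : ℝ → ℝ} {δ R : ℝ}
    (hpos : ∀ x, 0 < x → 0 < V x) (hsmall : ∀ x, 0 < x → x < R → V x ≤ 1 / 4)
    (hTV : (∀ x : Icc (0 : ℝ) 1, (x : ℝ) < δ → (T x : ℝ) = x * (1 + V x)) ∨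
        (∀ x : Icc (0 : ℝ) 1, (x : ℝ) < δ → (T x : ℝ) = x * (1 - V x))) :
    ∃ ε : ℝ, (ε = 1 ∨ ε = -1) ∧ ∀ x : Icc (0 : ℝ) 1, 0 < (x : ℝ) → (x : ℝ) < min δ R →
      ∃ h, V x / 2 ≤ h ∧ h ≤ 2 * V x ∧ Real.log (T x) = Real.log x + ε * h := by
  rcases hTV with hTV | hTV
  · refine ⟨1, .inl rfl, fun x hx hxr => ⟨Real.log (1 + V x), ?_, ?_, ?_⟩⟩
    · have h1 := hpos x hx
      have h2 := hsmall x hx (hxr.trans_le (min_le_right _ _))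
      refine le_trans ?_ (Real.one_sub_inv_le_log_of_pos (by linarith))
      rw [le_sub_iff_add_le, ← le_sub_iff_add_le', inv_le_comm₀ (by linarith) (by linarith),
        inv_le_iff_one_le_mul₀ (by linarith)]
      nlinarith
    · have h1 := hpos x hx
      linarith [Real.log_le_sub_one_of_pos (show 0 < 1 + V x by linarith)]
    · have h1 := hpos x hx
      rw [hTV x (hxr.trans_le (min_le_left _ _)), Real.log_mul hx.ne' (by linarith), one_mul]
  · refine ⟨-1, .inr rfl, fun x hx hxr => ⟨-Real.log (1 - V x), ?_, ?_, ?_⟩⟩ <;>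
    have h1 := hpos x hx <;>
    have h2 := hsmall x hx (hxr.trans_le (min_le_right _ _))
    · linarith [Real.log_le_sub_one_of_pos (show 0 < 1 - V x by linarith)]
    · refine (neg_le_neg (Real.one_sub_inv_le_log_of_pos (by linarith))).trans ?_
      rw [neg_sub, sub_le_iff_le_add', inv_le_iff_one_le_mul₀ (by linarith)]
      nlinarith
    · rw [hTV x (hxr.trans_le (min_le_left _ _)), Real.log_mul hx.ne' (by linarith)]
      ring

section Dynamics

variable {T : Icc (0 : ℝ) 1 → Icc (0 : ℝ) 1} {V : ℝ → ℝ} {ε r K : ℝ}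

lemma logOscillation_le_coboundary (hV : MonotoneOn V (Ici 0))
    (hmem : ∀ x, 0 < x → V x ∈ Ioo (0 : ℝ) 1) (hr : 0 < r) (hT0 : T 0 = 0)
    (hε : ε = 1 ∨ ε = -1)
    (hstep : ∀ x : Icc (0 : ℝ) 1, 0 < (x : ℝ) → (x : ℝ) < 2 * r →
      ∃ h, V x / 2 ≤ h ∧ h ≤ 2 * V x ∧ Real.log (T x) = Real.log x + ε * h)
    (hsmall : ∀ x, 0 < x → x < 2 * r → V x ≤ 1 / 4)
    (hK : ∀ x, 0 < x → x < 2 * r → 2 * V x ≤ K * meanValue V x) (x : Icc (0 : ℝ) 1) :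
    logOscillation V K r x ≤ ε * Real.sin (Real.log (T x)) - ε * Real.sin (Real.log x) := by
  have hpos : ∀ x, 0 < x → 0 < V x := fun x hx => (hmem x hx).1
  rcases x.2.1.eq_or_lt with hx | hx
  · have : x = 0 := Subtype.ext hx.symm
    subst this
    simp [hT0, logOscillation_zero V K hr.le]
  have hg := meanValue_nonneg hV hpos hx.le
  have hg' := meanValue_le hV hx
  have hVx := hmem x hx
  rcases lt_or_ge (x : ℝ) (2 * r) with hxr | hxr
  · obtain ⟨h, h1, h2, h3⟩ := hstep x hx hxr
    have h4 := hsmall x hx hxr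
    have h5 := hK x hx hxr
    rw [h3]
    refine le_trans ?_ (cosWeight_mul_le hg (by linarith) (by linarith) (by linarith)
      (h2.trans h5) hε)
    exact sub_le_self _ (by positivity)
  · have h1 : cosWeight K (Real.log x) * meanValue V x ≤ 1 / 4 := by
      have := mul_le_mul_of_nonneg_right (cosWeight_le K (Real.log x)) hg
      linarith [hVx.2]
    have h2 : 3 ≤ 3 / r * max ((x : ℝ) - r) 0 := by
      calc (3 : ℝ) = 3 / r * r := by field_simp
        _ ≤ _ := by gcongr; exact (by linarith : r ≤ x - r).trans (le_max_left _ _)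
    have hs : ∀ t, |ε * Real.sin t| ≤ 1 := fun t => by
      rcases hε with rfl | rfl <;> simpa using Real.abs_sin_le_one t
    have h3 := abs_le.1 (hs (Real.log (T x)))
    have h4 := abs_le.1 (hs (Real.log x))
    rw [logOscillation]
    linarith [h3.1, h4.2]

lemma not_continuous_of_logOscillation_le (hV : MonotoneOn V (Ici 0))
    (hmem : ∀ x, 0 < x → V x ∈ Ioo (0 : ℝ) 1) (hr : 0 < r) (hε : ε = 1 ∨ ε = -1)
    (hstep : ∀ x : Icc (0 : ℝ) 1, 0 < (x : ℝ) → (x : ℝ) < 2 * r →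
      ∃ h, V x / 2 ≤ h ∧ h ≤ 2 * V x ∧ Real.log (T x) = Real.log x + ε * h)
    (hsmall : ∀ x, 0 < x → x < 2 * r → V x ≤ 1 / 4) (hK0 : 1 / 2 ≤ K)
    (hK : ∀ x, 0 < x → x < 2 * r → 2 * V x ≤ K * meanValue V x) {u : Icc (0 : ℝ) 1 → ℝ}
    (hu : ∀ x : Icc (0 : ℝ) 1, logOscillation V K r x + u x - u (T x) ≤ 0) : ¬ Continuous u := by
  intro hcont
  have hpos : ∀ x, 0 < x → 0 < V x := fun x hx => (hmem x hx).1
  have hεε : ε * ε = 1 := by rcases hε with rfl | rfl <;> norm_num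
  have hεabs : |ε| = 1 := by rcases hε with rfl | rfl <;> norm_num
  obtain ⟨c, hc⟩ : ∃ c, c = 3 / (16 * K) := ⟨_, rfl⟩
  have hc0 : 0 < c := by rw [hc]; positivity
  obtain ⟨ρ, hρ, hball⟩ := Metric.continuousAt_iff.1 (hcont.continuousAt (x := 0)) (c / 2)
    (half_pos hc0)
  have hlim : Tendsto (fun k : ℕ => Real.exp (1 - k * (2 * Real.pi))) atTop (𝓝 0) := by
    refine Real.tendsto_exp_atBot.comp (tendsto_atBot_add_const_left _ 1
      (tendsto_neg_atTop_atBot.comp ?_))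
    exact tendsto_natCast_atTop_atTop.atTop_mul_const (by positivity)
  obtain ⟨k, hk, hk1⟩ := ((hlim.eventually_lt_const (lt_min hρ (lt_min hr one_pos))).and
    (eventually_ge_atTop 1)).exists
  obtain ⟨s, hs⟩ : ∃ s, s = k * (2 * Real.pi) := ⟨_, rfl⟩
  have hs1 : 1 < s := by
    have : (1 : ℝ) ≤ k := by exact_mod_cast hk1
    rw [hs]
    nlinarith [Real.pi_gt_three]
  rw [← hs, lt_min_iff, lt_min_iff] at hk
  obtain ⟨hkρ, hkr, hk1'⟩ := hk
  have hband : ∀ x : Icc (0 : ℝ) 1, |ε * (Real.log x + s)| ≤ 1 →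
      0 < (x : ℝ) ∧ (x : ℝ) ≤ Real.exp (1 - s) := fun x hx => by
    rw [abs_mul, hεabs, one_mul, abs_le] at hx
    refine ⟨x.2.1.lt_of_ne fun h => ?_, (Real.le_exp_log _).trans (Real.exp_le_exp.2 ?_)⟩
    · rw [← h, Real.log_zero] at hx
      linarith [hx.2]
    · linarith [hx.2]
  have hclose : ∀ x : Icc (0 : ℝ) 1, |ε * (Real.log x + s)| ≤ 1 → |u x - u 0| < c / 2 :=
    fun x hx => by
    have h := hband x hx
    rw [← Real.dist_eq]
    apply hball
    rw [Subtype.dist_eq, Real.dist_eq, Icc.coe_zero, sub_zero, abs_of_pos h.1]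
    exact h.2.trans_lt hkρ
  let a : Icc (0 : ℝ) 1 := ⟨Real.exp (-s - ε / 2), (Real.exp_pos _).le, by
    refine le_trans (Real.exp_le_exp.2 ?_) hk1'.le
    linarith [abs_le.1 hεabs.le]⟩
  have ha : ε * (Real.log a + s) = -1 / 2 := by
    simp only [a, Real.log_exp]
    linarith
  have hcross : ∀ x : Icc (0 : ℝ) 1, |ε * (Real.log x + s)| ≤ 1 / 2 →
      ε * (Real.log x + s) + V (Real.exp (-s - 1 / 2)) / 2 ≤ ε * (Real.log (T x) + s) ∧
      ε * (Real.log (T x) + s) ≤ ε * (Real.log x + s) + 1 / 2 ∧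
      c * (ε * (Real.log (T x) + s) - ε * (Real.log x + s)) ≤ u (T x) - u x := by
    intro x hx
    obtain ⟨hx0, hxe⟩ := hband x (hx.trans (by norm_num))
    have hxr : (x : ℝ) < r := hxe.trans_lt hkr
    have hxr' : (x : ℝ) < 2 * r := by linarith
    obtain ⟨h, h1, h2, h3⟩ := hstep x hx0 hxr'
    have h4 := hsmall x hx0 hxr'
    have h5 := hK x hx0 hxr'
    have hy : ε * (Real.log (T x) + s) = ε * (Real.log x + s) + h := by
      rw [h3]; linear_combination h * hεε
    have hx' : |Real.log x + s| ≤ 1 / 2 := by rwa [abs_mul, hεabs, one_mul] at hx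
    have hcos : 7 / 8 ≤ Real.cos (Real.log x) := by
      rw [← Real.cos_add_nat_mul_two_pi _ k, ← hs]
      have := Real.one_sub_sq_div_two_le_cos (x := Real.log x + s)
      have h6 := sq_le_sq' (abs_le.1 hx').1 (abs_le.1 hx').2
      linarith
    have hosc : c * h ≤ logOscillation V K r x := by
      have hw : 3 / 16 ≤ cosWeight K (Real.log x) := le_min (by linarith) (by nlinarith)
      rw [logOscillation, max_eq_right (by linarith), mul_zero, sub_zero]
      calc c * h ≤ c * (K * meanValue V x) := by gcongr; exact h2.trans h5
        _ = 3 / 16 * meanValue V x := by rw [hc]; field_simp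
        _ ≤ _ := by
          gcongr
          exact meanValue_nonneg hV hpos hx0.le
    have hVlow : V (Real.exp (-s - 1 / 2)) ≤ V x := by
      refine hV (Real.exp_pos _).le hx0.le ((Real.le_log_iff_exp_le hx0).1 ?_)
      linarith [(abs_le.1 hx').1]
    refine ⟨by rw [hy]; linarith, by rw [hy]; linarith, ?_⟩
    rw [hy, add_sub_cancel_left]
    linarith [hu x]
  obtain ⟨z, hz, huz⟩ := exists_add_le_of_crossing (half_pos (hpos _ (Real.exp_pos (-s - 1 / 2))))
    hc0.le hcross ha
  have h1 := abs_lt.1 (hclose a (by rw [ha, abs_le]; norm_num))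
  have h2 := abs_lt.1 (hclose z (abs_le.2 ⟨by linarith [hz.1], hz.2⟩))
  linarith [h1.1, h2.2]

end Dynamics

theorem theorem1 (T : Icc (0 : ℝ) 1 → Icc (0 : ℝ) 1) (hT : Measurable T)
    (V : ℝ → ℝ) (hVcont : ContinuousOn V (Ici 0)) (hVmono : MonotoneOn V (Ici 0))
    (hVmem : ∀ x : ℝ, 0 < x → V x ∈ Ioo (0 : ℝ) 1)
    (σ : ℝ) (hσ : 0 < σ) (hVreg : RegularlyVaryingAtZero V σ)
    (hTV : ∃ δ : ℝ, 0 < δ ∧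
      InjOn T {x | (x : ℝ) < δ} ∧
      ((∀ x : Icc (0 : ℝ) 1, (x : ℝ) < δ → (T x : ℝ) = x * (1 + V x)) ∨
        (∀ x : Icc (0 : ℝ) 1, (x : ℝ) < δ → (T x : ℝ) = x * (1 - V x))))
    (ω : ℝ → ℝ) (hω : IsConcaveModulus ω)
    (hliminf : 0 < liminf (fun x : ℝ => ((ω x / V x : ℝ) : EReal)) (𝓝[>] 0)) :
    ∃ f ∈ ModulusClass ω,
      IsGreatest (ergodicAverages T f) (maxErgodicAverage T f) ∧
      maxErgodicAverage T f = ∫ x, f x ∂(Measure.dirac (0 : Icc (0 : ℝ) 1)) ∧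
      maxErgodicAverage T f = f 0 ∧
      ¬ ∃ u : Icc (0 : ℝ) 1 → ℝ, Continuous u ∧ IsSubAction T f u := by
  have hpos : ∀ x, 0 < x → 0 < V x := fun x hx => (hVmem x hx).1
  obtain ⟨δ, hδ, -, hTV⟩ := hTV
  obtain ⟨c, hc, hle⟩ := hω.exists_mul_le hVmem hliminf
  obtain ⟨R, hR, hsmall⟩ := hω.exists_le_quarter hc hle
  obtain ⟨K, hK0, R', hR', hK⟩ := hVreg.exists_two_mul_le_meanValue hVmono hpos
  obtain ⟨ε, hε, hstep⟩ := exists_log_step hpos hsmall hTV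
  have hT0 : T 0 = 0 := by
    apply Subtype.ext
    rcases hTV with h | h <;> rw [h 0 hδ] <;> simp
  obtain ⟨r, hr, hrδ, hrR, hrR'⟩ : ∃ r, 0 < r ∧ 2 * r ≤ δ ∧ 2 * r ≤ R ∧ 2 * r ≤ R' := by
    refine ⟨min δ (min R R') / 2, half_pos (lt_min hδ (lt_min hR hR')), ?_⟩
    rw [mul_div_cancel₀ _ two_ne_zero]
    exact ⟨min_le_left _ _, (min_le_right _ _).trans (min_le_left _ _),
      (min_le_right _ _).trans (min_le_right _ _)⟩
  replace hstep := fun (x : Icc (0 : ℝ) 1) (hx : 0 < (x : ℝ)) (hxr : (x : ℝ) < 2 * r) =>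
    hstep x hx (hxr.trans_le (le_min hrδ hrR))
  replace hsmall := fun x (hx : 0 < x) (hxr : x < 2 * r) => hsmall x hx (hxr.trans_le hrR)
  replace hK := fun x (hx : 0 < x) (hxr : x < 2 * r) => hK x hx (hxr.trans_le hrR')
  have hf := logOscillation_mem_modulusClass hω hVmono hVmem hc hle hK0 hr
  have hcont := hω.continuous_of_mem hf
  have hf0 : logOscillation V K r (0 : Icc (0 : ℝ) 1) = 0 := logOscillation_zero V K hr.le
  have hgreatest : IsGreatest (ergodicAverages T fun x => logOscillation V K r x) 0 := by
    refine ⟨⟨Measure.dirac 0, inferInstance, ⟨hT, ?_⟩, ?_⟩, ?_⟩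
    · rw [Measure.map_dirac, hT0]
    · rw [integral_dirac, hf0]
    · rintro _ ⟨μ, hμ, hTμ, rfl⟩
      refine integral_nonpos_of_le_coboundary hTμ
        (hcont.integrable_of_hasCompactSupport (HasCompactSupport.of_compactSpace _))
        (w := fun x => ε * Real.sin (Real.log x)) (by fun_prop) (B := 1) (fun x => ?_)
        (logOscillation_le_coboundary hVmono hVmem hr hT0 hε hstep hsmall hK)
      rcases hε with rfl | rfl <;> simpa using Real.abs_sin_le_one _
  have hmax : maxErgodicAverage T (fun x => logOscillation V K r x) = 0 := hgreatest.csSup_eq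
  refine ⟨fun x => logOscillation V K r x, hf, by rwa [hmax], ?_, hmax.trans hf0.symm, ?_⟩
  · rw [hmax, integral_dirac, hf0]
  · rintro ⟨u, hu, hsub⟩
    refine not_continuous_of_logOscillation_le hVmono hVmem hr hε hstep hsmall hK0 hK
      (fun x => ?_) hu
    simpa only [hmax] using hsub x
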